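/- There is an absolute constant $C>0$ such that the following holds. Let $S$ be a compact metric space, let $\mathcal C(S)$ be the Banach space of continuous real-valued functions on $S$ with the supremum norm, and let $K\subset\mathcal C(S)$ be compact. For $n\ge 1$ let $\varepsilon_n(K)_{\mathcal C(S)}$ be the infimum of all $\varepsilon>0$ for which $2^n$ balls of radius $\varepsilon$ in $\mathcal C(S)$ cover $K$. Then for each integer $n\ge 1$ there are maps $$a_n:\mathcal C(S)\to\ell_2^{26n},\qquad M_n:\ell_2^{26n}\to\mathcal C(S),$$ both Lipschitz with constant $Cn^{3/4}$, where $\ell_2^{26n}$ is $\mathbb R^{26n}$ with the Euclidean norm, such that $$\sup_{f\in K}\|f-M_n(a_n(f))\|_{\mathcal C(S)}\le C\,n^{3/2}\,\varepsilon_n(K)_{\mathcal C(S)}.$$ -/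

import Mathlib

open scoped NNReal

/-- The entropy number `ε_n(K)` of a subset `K` of a metric space `X`: the infimum of all `ε > 0`
for which `2 ^ n` balls of radius `ε`, with centres anywhere in `X` and not necessarily distinct,
cover `K`. (It does not matter for the infimum whether the balls are open or closed. For bounded
`K` the infimum is over a nonempty set that is bounded below by `0`.) -/
noncomputable def entropyNumber {X : Type*} [PseudoMetricSpace X] (n : ℕ) (K : Set X) : ℝ :=
  sInf {ε : ℝ | 0 < ε ∧ ∃ c : Fin (2 ^ n) → X, K ⊆ ⋃ i, Metric.closedBall (c i) ε}

/-! Cover `K` by `2 ^ n` balls and make encoding and decoding exact on the centres. It then suffices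
that the finite set of centres embeds in `ℓ_2^{26n}` with distortion `O(n^{3/2})` by a map Lipschitz
on all of `C(S)`. The inverse extends from the image to the whole Euclidean space by McShane's
formula, applied pointwise on `S`, and dividing by `n^{3/4}` splits the distortion equally. A point
`f` near a centre `c` is recovered up to `dist f c` times one plus the product of the Lipschitz
constants.

The embedding is Bourgain's, with random signs to save coordinates. For points at distance `D`,
distances to random sets of densities `2^{-(t+1)}`, `t < n`, differ by `ρ t` with constant
probability, where `∑ ρ t ≥ D/2` (`exists_bourgain_scales`). A signed sum over all scales then has a
difference of order at least `D/√n` with constant probability (`sum_exp_neg_signedSum_sq_le`).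
Multiplying Laplace transforms over `26 n` independent coordinates beats the union bound over `4 ^
n` pairs (`exists_separating_coords`). The upper bound is deterministic: each coordinate is
`8n`-Lipschitz, so the vector is `O(n^{3/2})`-Lipschitz. -/

/-- The sign `±1` attached to a Boolean. -/
def boolSign (b : Bool) : ℝ := if b then 1 else -1

lemma boolSign_not (b : Bool) : boolSign (!b) = -boolSign b := by
  cases b <;> simp [boolSign]

lemma boolSign_sq (b : Bool) : boolSign b ^ 2 = 1 := by
  cases b <;> simp [boolSign]

lemma abs_boolSign (b : Bool) : |boolSign b| = 1 := by
  cases b <;> simp [boolSign]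

/-! ### Moments and small-ball estimate of Rademacher sums -/

section Rademacher

variable {ι : Type*} [DecidableEq ι]

/-- Flipping the `i`-th sign pairs each term with its negative. -/
lemma sum_boolSign_mul_eq_zero [Fintype ι] (i : ι) (g : (ι → Bool) → ℝ)
    (hg : ∀ σ, g (Function.update σ i (!σ i)) = g σ) :
    ∑ σ : ι → Bool, boolSign (σ i) * g σ = 0 := by
  have hinv : Function.Involutive (fun σ : ι → Bool => Function.update σ i (!σ i)) := by
    intro σ
    simp
  have h := Equiv.sum_comp (Function.Involutive.toPerm _ hinv)
    (fun σ : ι → Bool => boolSign (σ i) * g σ)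
  simp only [Function.Involutive.coe_toPerm, hg, Function.update_self, boolSign_not, neg_mul,
    Finset.sum_neg_distrib] at h
  linarith

/-- The signed sum `∑ i ∈ s, ± a i`. -/
def signedSum (s : Finset ι) (a : ι → ℝ) (σ : ι → Bool) : ℝ :=
  ∑ i ∈ s, boolSign (σ i) * a i

lemma signedSum_update (s : Finset ι) (a : ι → ℝ) (σ : ι → Bool) {i : ι} (hi : i ∉ s) (b : Bool) :
    signedSum s a (Function.update σ i b) = signedSum s a σ := by
  refine Finset.sum_congr rfl fun k hk => ?_
  rw [Function.update_of_ne (ne_of_mem_of_not_mem hk hi)]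

variable [Fintype ι]

lemma sum_signedSum_sq (s : Finset ι) (a : ι → ℝ) :
    ∑ σ : ι → Bool, signedSum s a σ ^ 2
      = Fintype.card (ι → Bool) * ∑ i ∈ s, a i ^ 2 := by
  induction s using Finset.induction_on with
  | empty => simp [signedSum]
  | insert i s hi ih =>
    have h : ∀ σ : ι → Bool, signedSum (insert i s) a σ ^ 2
        = a i ^ 2 + boolSign (σ i) * (2 * a i * signedSum s a σ) + signedSum s a σ ^ 2 := by
      intro σ
      have : signedSum (insert i s) a σ = boolSign (σ i) * a i + signedSum s a σ :=
        Finset.sum_insert hi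
      rw [this]
      linear_combination a i ^ 2 * boolSign_sq (σ i)
    rw [Finset.sum_congr rfl (fun σ _ => h σ), Finset.sum_add_distrib, Finset.sum_add_distrib, ih,
      sum_boolSign_mul_eq_zero i _ (fun σ => by rw [signedSum_update s a σ hi]),
      Finset.sum_insert hi, Finset.sum_const, Finset.card_univ, nsmul_eq_mul]
    ring

/-- Khintchine's inequality for exponent four: expand in one new sign, whose odd powers average to
zero. The slack at each step is `2 * a i ^ 4`. -/
lemma sum_signedSum_pow_four_le (s : Finset ι) (a : ι → ℝ) :
    ∑ σ : ι → Bool, signedSum s a σ ^ 4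
      ≤ Fintype.card (ι → Bool) * (3 * (∑ i ∈ s, a i ^ 2) ^ 2) := by
  induction s using Finset.induction_on with
  | empty => simp [signedSum]
  | insert i s hi ih =>
    have h : ∀ σ : ι → Bool, signedSum (insert i s) a σ ^ 4
        = a i ^ 4 + boolSign (σ i) * (4 * a i ^ 3 * signedSum s a σ + 4 * a i * signedSum s a σ ^ 3)
          + 6 * a i ^ 2 * signedSum s a σ ^ 2 + signedSum s a σ ^ 4 := by
      intro σ
      have : signedSum (insert i s) a σ = boolSign (σ i) * a i + signedSum s a σ :=
        Finset.sum_insert hi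
      rw [this]
      linear_combination (a i ^ 4 * (boolSign (σ i) ^ 2 + 1)
        + 4 * boolSign (σ i) * a i ^ 3 * signedSum s a σ
        + 6 * a i ^ 2 * signedSum s a σ ^ 2) * boolSign_sq (σ i)
    rw [Finset.sum_congr rfl (fun σ _ => h σ), Finset.sum_add_distrib, Finset.sum_add_distrib,
      Finset.sum_add_distrib, ← Finset.mul_sum, sum_signedSum_sq,
      sum_boolSign_mul_eq_zero i _ (fun σ => by rw [signedSum_update s a σ hi]),
      Finset.sum_insert hi, Finset.sum_const, Finset.card_univ, nsmul_eq_mul]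
    have hc : (0 : ℝ) ≤ (Fintype.card (ι → Bool) : ℝ) * a i ^ 4 := by positivity
    nlinarith [ih, hc]

/-- `(1 + u + u²/2)(1 - u + u²/2) = 1 + u⁴/4 ≥ 1`. -/
lemma Real.exp_neg_le_quadratic {u : ℝ} (hu : 0 ≤ u) : Real.exp (-u) ≤ 1 - u + u ^ 2 / 2 := by
  have h1 : 1 + u + u ^ 2 / 2 ≤ Real.exp u := Real.quadratic_le_exp_of_nonneg hu
  rw [Real.exp_neg]
  have h0 : 0 < 1 + u + u ^ 2 / 2 := by positivity
  refine (inv_anti₀ h0 h1).trans ?_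
  rw [inv_le_iff_one_le_mul₀ h0]
  nlinarith [sq_nonneg (u ^ 2)]

/-- A small-ball estimate for Rademacher sums, in Laplace transform form. -/
lemma sum_exp_neg_signedSum_sq_le (a : ι → ℝ) {c V θ : ℝ} (hV : 0 < V) (hθ : 0 ≤ θ)
    (hθ1 : θ ≤ 1) (hW : θ * V ≤ ∑ i, a i ^ 2) (hc : 1 ≤ c * (3 * V)) :
    ∑ σ : ι → Bool, Real.exp (-(c * signedSum Finset.univ a σ ^ 2))
      ≤ Fintype.card (ι → Bool) * (1 - θ / 6) := by
  set W := ∑ i, a i ^ 2 with hWdef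
  have hc0 : 0 < c := by
    by_contra! h
    nlinarith
  -- Lowering `c` to `d` only increases the exponential. With `d * W = θ / 3` the quadratic bound
  -- averages to at most `1 - θ/3 + θ²/6 ≤ 1 - θ/6`.
  obtain ⟨d, hd0, hdc, hdW⟩ : ∃ d, 0 ≤ d ∧ d ≤ c ∧ d * W = θ / 3 := by
    rcases hθ.eq_or_lt with h | h
    · exact ⟨0, le_rfl, hc0.le, by simp [← h]⟩
    · have hWpos : 0 < W := (mul_pos h hV).trans_le hW
      refine ⟨θ / (3 * W), by positivity, ?_, by field_simp⟩
      rw [div_le_iff₀ (by positivity)]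
      nlinarith
  have key : ∀ σ : ι → Bool, Real.exp (-(c * signedSum Finset.univ a σ ^ 2))
      ≤ 1 - d * signedSum Finset.univ a σ ^ 2 + d ^ 2 / 2 * signedSum Finset.univ a σ ^ 4 := by
    intro σ
    have h1 : Real.exp (-(c * signedSum Finset.univ a σ ^ 2))
        ≤ Real.exp (-(d * signedSum Finset.univ a σ ^ 2)) := by
      gcongr
    refine h1.trans ((Real.exp_neg_le_quadratic (by positivity)).trans (le_of_eq (by ring)))
  refine (Finset.sum_le_sum fun σ _ => key σ).trans ?_
  rw [Finset.sum_add_distrib, Finset.sum_sub_distrib, ← Finset.mul_sum, ← Finset.mul_sum,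
    sum_signedSum_sq, Finset.sum_const, Finset.card_univ, nsmul_eq_mul, ← hWdef]
  have h4 := sum_signedSum_pow_four_le Finset.univ a
  rw [← hWdef] at h4
  set N : ℝ := (Fintype.card (ι → Bool) : ℝ) with hN
  have hN0 : 0 ≤ N := by positivity
  have h5 := mul_le_mul_of_nonneg_left h4 (show 0 ≤ d ^ 2 / 2 by positivity)
  have h6 : d ^ 2 / 2 * (N * (3 * W ^ 2)) = N * (3 / 2 * (θ / 3) ^ 2) := by
    rw [← hdW]; ring
  have h7 : d * (N * W) = N * (θ / 3) := by rw [← hdW]; ring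
  rw [h6] at h5
  rw [h7]
  have h8 : 0 ≤ N * (θ * (1 - θ)) := mul_nonneg hN0 (mul_nonneg hθ (by linarith))
  nlinarith

end Rademacher

/-! ### Random subsets of a finite set -/

section Sampling

variable {P : Type*} [Fintype P] [DecidableEq P]

lemma card_forall_le_val (M h : ℕ) (hM : 0 < M) (hh : h ≤ M) (B : Finset P) :
    ((Finset.univ.filter fun ω : P → Fin M => ∀ i ∈ B, h ≤ (ω i : ℕ)).card : ℝ)
      = Fintype.card (P → Fin M) * (1 - (h : ℝ) / M) ^ B.card := by
  have h1 : (Finset.univ.filter fun ω : P → Fin M => ∀ i ∈ B, h ≤ (ω i : ℕ))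
      = Fintype.piFinset fun i => if i ∈ B then Finset.univ.filter (fun v : Fin M => h ≤ (v : ℕ))
        else Finset.univ := by
    ext ω
    simp only [Finset.mem_filter, Finset.mem_univ, true_and, Fintype.mem_piFinset]
    refine forall_congr' fun i => ?_
    by_cases hi : i ∈ B <;> simp [hi]
  have h2 : (Finset.univ.filter (fun v : Fin M => h ≤ (v : ℕ))).card = M - h := by
    have e : (Finset.univ.filter (fun v : Fin M => h ≤ (v : ℕ))).card
        = ((Finset.range M).filter (fun v => h ≤ v)).card := by
      rw [← Finset.card_map Fin.valEmbedding]
      congr 1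
      ext v
      simp only [Finset.mem_map, Finset.mem_filter, Finset.mem_univ, true_and, Finset.mem_range,
        Fin.valEmbedding_apply]
      constructor
      · rintro ⟨w, hw, rfl⟩
        exact ⟨w.2, hw⟩
      · rintro ⟨hv, hw⟩
        exact ⟨⟨v, hv⟩, hw, rfl⟩
    rw [e]
    have : (Finset.range M).filter (fun v => h ≤ v) = Finset.Ico h M := by
      ext v
      simp [and_comm]
    rw [this, Nat.card_Ico]
  have hM' : (M : ℝ) ≠ 0 := by positivity
  have h3 : ∀ i : P, (((if i ∈ B then Finset.univ.filter (fun v : Fin M => h ≤ (v : ℕ))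
        else Finset.univ).card : ℕ) : ℝ) = M * (if i ∈ B then (1 - (h : ℝ) / M) else 1) := by
    intro i
    split_ifs
    · rw [h2, Nat.cast_sub hh]
      field_simp
    · simp
  rw [h1, Fintype.card_piFinset, Nat.cast_prod, Finset.prod_congr rfl (fun i _ => h3 i),
    Finset.prod_mul_distrib]
  simp

/-- A random set of density `1 / (2 * k)` meets `B` and avoids `B'` with probability at least `1/8`,
if `B` has at least `k` elements and `B'` at most `2 * k`. -/
lemma card_hit_and_avoid (M h k : ℕ) (hM : 0 < M) (hk : 0 < k) (hkM : h * (2 * k) = M)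
    (B B' : Finset P) (hdisj : Disjoint B B') (hB : k ≤ B.card) (hB' : B'.card ≤ 2 * k) :
    (1 / 8 : ℝ) * Fintype.card (P → Fin M) ≤
      ((Finset.univ.filter fun ω : P → Fin M =>
        (∃ i ∈ B, (ω i : ℕ) < h) ∧ ∀ i ∈ B', h ≤ (ω i : ℕ)).card : ℝ) := by
  have hh : h ≤ M := by
    rw [← hkM]
    exact Nat.le_mul_of_pos_right _ (by omega)
  -- Avoiding `B'` splits into hitting or also avoiding `B`, so by independence the wanted
  -- probability is `y ^ |B'| * (1 - y ^ |B|)`.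
  have hsplit : (Finset.univ.filter fun ω : P → Fin M => ∀ i ∈ B', h ≤ (ω i : ℕ)).card
      = (Finset.univ.filter fun ω : P → Fin M =>
          (∃ i ∈ B, (ω i : ℕ) < h) ∧ ∀ i ∈ B', h ≤ (ω i : ℕ)).card
        + (Finset.univ.filter fun ω : P → Fin M => ∀ i ∈ B ∪ B', h ≤ (ω i : ℕ)).card := by
    rw [← Finset.card_union_of_disjoint]
    · congr 1
      ext ω
      simp only [Finset.mem_filter, Finset.mem_univ, true_and, Finset.mem_union]
      by_cases hx : ∃ i ∈ B, (ω i : ℕ) < h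
      · simp only [hx, true_and]
        refine ⟨Or.inl, fun h' => h'.elim id fun h'' i hi => h'' i (Or.inr hi)⟩
      · simp only [hx, false_and, false_or]
        push Not at hx
        exact ⟨fun h' i hi => hi.elim (hx i) (h' i), fun h' i hi => h' i (Or.inr hi)⟩
    · rw [Finset.disjoint_filter]
      rintro ω - ⟨⟨i, hi, hlt⟩, -⟩ hall
      exact absurd (hall i (Finset.mem_union_left _ hi)) (by omega)
  have hsplit' := congrArg (Nat.cast (R := ℝ)) hsplit
  rw [Nat.cast_add, card_forall_le_val M h hM hh, card_forall_le_val M h hM hh,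
    Finset.card_union_of_disjoint hdisj] at hsplit'
  have hδ : (h : ℝ) / M = 1 / (2 * k) := by
    have : (M : ℝ) = h * (2 * k) := by rw [← hkM]; push_cast; ring
    have hM0 : (M : ℝ) ≠ 0 := by positivity
    have hk0 : (k : ℝ) ≠ 0 := by positivity
    rw [div_eq_div_iff hM0 (by positivity), this]
    ring
  rw [hδ] at hsplit'
  have hk1 : (1 : ℝ) ≤ k := by exact_mod_cast hk
  set y : ℝ := 1 - 1 / (2 * k) with hy
  have hδ1 : (1 : ℝ) / (2 * k) ≤ 1 / 2 := by
    rw [div_le_div_iff₀ (by positivity) (by norm_num)]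
    linarith
  have hδ0 : (0 : ℝ) < 1 / (2 * k) := by positivity
  have hy0 : 0 ≤ y := by linarith
  have hy1 : y ≤ 1 := by linarith
  set u : ℝ := y ^ k with hu
  have hu1 : 1 / 2 ≤ u := by
    have := one_add_mul_le_pow (a := -(1 / (2 * (k : ℝ)))) (by linarith) k
    have e : (1 : ℝ) + k * -(1 / (2 * (k : ℝ))) = 1 / 2 := by field_simp; norm_num
    rw [e, ← sub_eq_add_neg] at this
    exact this
  -- Bernoulli gives `(1 + 1/(2k))^k ≥ 3/2`, and its product with `u` is at most `1`.
  have hu2 : u ≤ 2 / 3 := by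
    have h1 := one_add_mul_le_pow (a := (1 / (2 * (k : ℝ)))) (by linarith) k
    have e : (1 : ℝ) + k * (1 / (2 * (k : ℝ))) = 3 / 2 := by field_simp; norm_num
    rw [e] at h1
    have h2 : u * (1 + 1 / (2 * (k : ℝ))) ^ k ≤ 1 := by
      rw [hu, ← mul_pow]
      refine pow_le_one₀ (by positivity) ?_
      rw [hy]
      nlinarith [sq_nonneg (1 / (2 * (k : ℝ)))]
    nlinarith
  have hmiss : u ^ 2 ≤ y ^ B'.card := by
    rw [hu, ← pow_mul, mul_comm k 2]
    exact pow_le_pow_of_le_one hy0 hy1 hB'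
  have hhit : y ^ B.card ≤ u := pow_le_pow_of_le_one hy0 hy1 hB
  have hprob : 1 / 8 ≤ y ^ B'.card * (1 - y ^ B.card) := by
    have hquad := mul_nonneg (sub_nonneg.2 hu1) (sub_nonneg.2 hu2)
    have hcubic : 1 / 8 ≤ u ^ 2 * (1 - u) := by
      nlinarith [mul_nonneg hquad (by linarith : (0 : ℝ) ≤ u)]
    calc (1 / 8 : ℝ) ≤ u ^ 2 * (1 - u) := hcubic
      _ ≤ y ^ B'.card * (1 - y ^ B.card) := by
        apply mul_le_mul hmiss (by linarith) (by linarith) (by positivity)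
  have hN0 : (0 : ℝ) ≤ Fintype.card (P → Fin M) := by positivity
  have := mul_le_mul_of_nonneg_right hprob hN0
  rw [pow_add] at hsplit'
  linarith

end Sampling

/-! ### Bourgain's radii and scales -/

section Radii

variable {P : Type*}

/-- The radius is the `k`-th smallest value of `f`, with multiplicity. -/
lemma exists_rank_radius [Fintype P] (f : P → ℝ) (hf : ∀ i, 0 ≤ f i) {k : ℕ} (hk1 : 1 ≤ k)
    (hk : k ≤ Fintype.card P) :
    ∃ r, 0 ≤ r ∧ k ≤ (Finset.univ.filter fun i => f i ≤ r).card ∧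
      (Finset.univ.filter fun i => f i < r).card < k := by
  classical
  set R : Finset P := Finset.univ.filter fun v => k ≤ (Finset.univ.filter fun i => f i ≤ f v).card
    with hR
  have hne : (Finset.univ : Finset P).Nonempty := by
    rw [← Finset.card_pos, Finset.card_univ]
    omega
  have hRne : R.Nonempty := by
    obtain ⟨v, -, hv⟩ := Finset.exists_max_image Finset.univ f hne
    refine ⟨v, Finset.mem_filter.2 ⟨Finset.mem_univ _, ?_⟩⟩
    rw [Finset.filter_true_of_mem hv, Finset.card_univ]
    exact hk
  obtain ⟨v, hvR, hv⟩ := Finset.exists_min_image R f hRne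
  refine ⟨f v, hf v, (Finset.mem_filter.1 hvR).2, ?_⟩
  by_contra! hlt
  obtain ⟨w, hw, hwmax⟩ := Finset.exists_max_image (Finset.univ.filter fun i => f i < f v) f
    (Finset.card_pos.1 (by omega))
  have hwR : w ∈ R := by
    refine Finset.mem_filter.2 ⟨Finset.mem_univ _, hlt.trans (Finset.card_le_card fun i hi => ?_)⟩
    exact Finset.mem_filter.2 ⟨Finset.mem_univ _, hwmax i hi⟩
  exact absurd (hv w hwR) (not_le.2 (Finset.mem_filter.1 hw).2)

variable {X : Type*} [PseudoMetricSpace X]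

/-- The points `x k` whose label is less than `2 ^ (n - t - 1)`: for uniformly random labels a
random set of density `2 ^ (-(t + 1))`. -/
def sampleSet (n : ℕ) (x : P → X) (t : ℕ) (ω : P → Fin (2 ^ n)) : Set X :=
  x '' {k | (ω k : ℕ) < 2 ^ (n - t - 1)}

lemma sub_le_infDist_sub {A : Set X} {p q : X} {r r' : ℝ} (h1 : ∃ z ∈ A, dist p z ≤ r)
    (h2 : ∀ z ∈ A, r' ≤ dist q z) : r' - r ≤ Metric.infDist q A - Metric.infDist p A := by
  obtain ⟨z, hz, hzr⟩ := h1
  have e1 := (Metric.infDist_le_dist_of_mem (x := p) hz).trans hzr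
  have e2 : r' ≤ Metric.infDist q A := (Metric.le_infDist ⟨z, hz⟩).2 fun y hy => h2 y hy
  linarith

variable [Fintype P] [DecidableEq P]

/-- The bound on `r + r'` makes the two balls disjoint, so `card_hit_and_avoid` applies with `k = 2
^ t`: the sample hits the ball about `x i` and avoids the open one about `x j`. -/
lemma card_sampleSet_separates (n : ℕ) (x : P → X) (i j : P) (t : ℕ) (ht : t < n) {r r' : ℝ}
    (hrr : r + r' ≤ dist (x i) (x j))
    (hB : 2 ^ t ≤ (Finset.univ.filter fun k => dist (x i) (x k) ≤ r).card)
    (hB' : (Finset.univ.filter fun k => dist (x j) (x k) < r').card ≤ 2 ^ (t + 1)) :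
    (1 / 8 : ℝ) * Fintype.card (P → Fin (2 ^ n)) ≤
      ((Finset.univ.filter fun ω : P → Fin (2 ^ n) =>
        r' - r ≤ Metric.infDist (x j) (sampleSet n x t ω)
          - Metric.infDist (x i) (sampleSet n x t ω)).card : ℝ) := by
  have hdisj : Disjoint (Finset.univ.filter fun k => dist (x i) (x k) ≤ r)
      (Finset.univ.filter fun k => dist (x j) (x k) < r') := by
    rw [Finset.disjoint_filter]
    intro k _ h1 h2
    have := dist_triangle_right (x i) (x j) (x k)
    linarith
  refine (card_hit_and_avoid (2 ^ n) (2 ^ (n - t - 1)) (2 ^ t) (by positivity) (by positivity) ?_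
    _ _ hdisj hB (hB'.trans_eq (by ring))).trans ?_
  · rw [← pow_succ', ← pow_add]
    congr 1
    omega
  · refine Nat.cast_le.2 (Finset.card_le_card fun ω hω => ?_)
    obtain ⟨⟨k, hk, hkω⟩, hall⟩ := (Finset.mem_filter.1 hω).2
    refine Finset.mem_filter.2 ⟨Finset.mem_univ _, sub_le_infDist_sub
      ⟨x k, ⟨k, hkω, rfl⟩, (Finset.mem_filter.1 hk).2⟩ ?_⟩
    rintro _ ⟨l, hl, rfl⟩
    by_contra! hlt
    exact absurd (hall l (Finset.mem_filter.2 ⟨Finset.mem_univ _, hlt⟩)) (not_le.2 hl)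

/-- Bourgain's scales: the increments `ρ t` add up to half the distance of `x i` and `x j`, and each
is realised with probability at least `1/8` by a random set of the corresponding density. -/
lemma exists_bourgain_scales (n : ℕ) (hP : Fintype.card P = 2 ^ n) (x : P → X) (i j : P) :
    ∃ ρ : Fin n → ℝ, (∀ t, 0 ≤ ρ t) ∧ dist (x i) (x j) / 2 ≤ ∑ t, ρ t ∧
      ∀ t : Fin n, (1 / 8 : ℝ) * Fintype.card (P → Fin (2 ^ n)) ≤
        ((Finset.univ.filter fun ω : P → Fin (2 ^ n) =>
          ρ t ≤ |Metric.infDist (x i) (sampleSet n x t ω)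
            - Metric.infDist (x j) (sampleSet n x t ω)|).card : ℝ) := by
  have hex : ∀ (l : P) (t : ℕ), ∃ r : ℝ, 0 ≤ r ∧ (t ≤ n →
      2 ^ t ≤ (Finset.univ.filter fun k => dist (x l) (x k) ≤ r).card ∧
      (Finset.univ.filter fun k => dist (x l) (x k) < r).card < 2 ^ t) := by
    intro l t
    by_cases ht : t ≤ n
    · obtain ⟨r, h0, h⟩ := exists_rank_radius (fun k => dist (x l) (x k)) (fun _ => dist_nonneg)
        (Nat.one_le_two_pow (n := t)) (hP ▸ Nat.pow_le_pow_right (by norm_num) ht)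
      exact ⟨r, h0, fun _ => h⟩
    · exact ⟨0, le_rfl, fun h => absurd h ht⟩
  choose s hs0 hs using hex
  set D := dist (x i) (x j) with hD
  -- The cap `D / 2` keeps the balls disjoint. Below the cap, the maximum makes both closed balls
  -- rich in points, while the open ball about the point attaining the maximum stays poor.
  set r : ℕ → ℝ := fun t => min (D / 2) (max (s i t) (s j t)) with hr
  have hrD : ∀ t, r t ≤ D / 2 := fun t => min_le_left _ _
  have hzero : ∀ l, s l 0 = 0 := by
    intro l
    refine le_antisymm ?_ (hs0 l 0)
    by_contra! hpos
    have h1 := (hs l 0 (Nat.zero_le _)).2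
    have : 0 < (Finset.univ.filter fun k => dist (x l) (x k) < s l 0).card :=
      Finset.card_pos.2 ⟨l, by simpa using hpos⟩
    simp only [pow_zero] at h1
    omega
  have hr0 : r 0 = 0 := by
    simp only [hr, hzero, max_self]
    exact min_eq_right (by positivity)
  have hrn : r n = D / 2 := by
    refine min_eq_left ?_
    have h1 := (hs i n le_rfl).1
    rw [← hP, ← Finset.card_univ] at h1
    have h2 := Finset.eq_of_subset_of_card_le (Finset.filter_subset _ _) h1
    have h3 : j ∈ Finset.univ.filter fun k => dist (x i) (x k) ≤ s i n := by
      rw [h2]; exact Finset.mem_univ _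
    have h4 : D ≤ s i n := (Finset.mem_filter.1 h3).2
    have h5 : 0 ≤ D := dist_nonneg
    exact le_max_of_le_left (by linarith)
  -- Monotonicity of `r` is not needed: a negative increment is replaced by `0`, which is realised
  -- trivially.
  refine ⟨fun t => max 0 (r (t + 1) - r t), fun t => le_max_left _ _, ?_, ?_⟩
  · have h1 : ∑ t : Fin n, (r (t + 1) - r t) = D / 2 := by
      rw [Fin.sum_univ_eq_sum_range (fun t => r (t + 1) - r t), Finset.sum_range_sub, hr0, hrn,
        sub_zero]
    rw [← h1]
    exact Finset.sum_le_sum fun t _ => le_max_right _ _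
  · intro t
    beta_reduce
    have ht := t.2
    rcases le_or_gt (r (t + 1) - r t) 0 with hle | hlt
    · rw [max_eq_left hle, Finset.filter_true_of_mem (fun _ _ => abs_nonneg _), Finset.card_univ]
      have : (0 : ℝ) ≤ Fintype.card (P → Fin (2 ^ n)) := by positivity
      linarith
    · rw [max_eq_right hlt.le]
      have hrt : r t < D / 2 := by linarith [hrD (t + 1)]
      have hrt' : max (s i t) (s j t) ≤ r t := by
        rcases min_choice (D / 2) (max (s i t) (s j t)) with h | h
        · exact absurd h hrt.ne
        · exact h.ge
      have hclosed : ∀ l, s l t ≤ r t →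
          2 ^ (t : ℕ) ≤ (Finset.univ.filter fun k => dist (x l) (x k) ≤ r t).card := by
        intro l hl
        refine (hs l t ht.le).1.trans (Finset.card_le_card fun k hk => ?_)
        exact Finset.mem_filter.2 ⟨Finset.mem_univ _, (Finset.mem_filter.1 hk).2.trans hl⟩
      have hopen : ∀ l, r (t + 1) ≤ s l (t + 1) →
          (Finset.univ.filter fun k => dist (x l) (x k) < r (t + 1)).card ≤ 2 ^ ((t : ℕ) + 1) := by
        intro l hl
        refine (Finset.card_le_card fun k hk => ?_).trans (hs l (t + 1) ht).2.le
        exact Finset.mem_filter.2 ⟨Finset.mem_univ _, (Finset.mem_filter.1 hk).2.trans_le hl⟩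
      have hci := hclosed i ((le_max_left _ _).trans hrt')
      have hcj := hclosed j ((le_max_right _ _).trans hrt')
      have hsum : r t + r (t + 1) ≤ D := by linarith [hrD t, hrD (t + 1)]
      rcases le_total (s i (t + 1)) (s j (t + 1)) with hij | hij
      · have ho := hopen j ((min_le_right _ _).trans_eq (max_eq_right hij))
        refine (card_sampleSet_separates n x i j t ht hsum hci ho).trans ?_
        refine Nat.cast_le.2 (Finset.card_le_card fun ω hω => ?_)
        refine Finset.mem_filter.2 ⟨Finset.mem_univ _, ?_⟩
        rw [abs_sub_comm]
        exact (Finset.mem_filter.1 hω).2.trans (le_abs_self _)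
      · have ho := hopen i ((min_le_right _ _).trans_eq (max_eq_left hij))
        refine (card_sampleSet_separates n x j i t ht (by rwa [dist_comm]) hcj ho).trans ?_
        refine Nat.cast_le.2 (Finset.card_le_card fun ω hω => ?_)
        exact Finset.mem_filter.2 ⟨Finset.mem_univ _,
          (Finset.mem_filter.1 hω).2.trans (le_abs_self _)⟩

end Radii

/-- All `m` independent trials fail with probability at most `(1 - δ) ^ m`; this boosts the chance
of realising a scale from `1/8` to `1 - (7/8)^8`. -/
lemma card_exists_coord_ge {Ω : Type*} [Fintype Ω] (good : Ω → Prop)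
    [DecidablePred good] (m : ℕ) {δ : ℝ}
    (h : δ * Fintype.card Ω ≤ (Finset.univ.filter good).card) :
    (1 - (1 - δ) ^ m) * Fintype.card (Fin m → Ω) ≤
      ((Finset.univ.filter fun w : Fin m → Ω => ∃ j, good (w j)).card : ℝ) := by
  classical
  have hcompl := Finset.card_filter_add_card_filter_not (s := (Finset.univ : Finset Ω)) good
  have hcompl' := Finset.card_filter_add_card_filter_not
    (s := (Finset.univ : Finset (Fin m → Ω))) (fun w => ∃ j, good (w j))
  have hpi : (Finset.univ.filter fun w : Fin m → Ω => ¬ ∃ j, good (w j))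
      = Fintype.piFinset fun _ => Finset.univ.filter fun v => ¬ good v := by
    ext w
    simp
  rw [hpi, Fintype.card_piFinset, Finset.prod_const, Finset.card_univ, Finset.card_univ,
    Fintype.card_fin] at hcompl'
  rw [Finset.card_univ] at hcompl
  have e1 : ((Finset.univ.filter good).card : ℝ)
      + ((Finset.univ.filter fun v => ¬ good v).card : ℝ) = Fintype.card Ω := by
    exact_mod_cast hcompl
  have e2 : ((Finset.univ.filter fun w : Fin m → Ω => ∃ j, good (w j)).card : ℝ)
      + ((Finset.univ.filter fun v => ¬ good v).card : ℝ) ^ m = Fintype.card (Fin m → Ω) := by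
    exact_mod_cast hcompl'
  have e3 : ((Finset.univ.filter fun v => ¬ good v).card : ℝ) ^ m
      ≤ ((1 - δ) * Fintype.card Ω) ^ m :=
    pow_le_pow_left₀ (by positivity) (by linarith) m
  have e4 : (Fintype.card (Fin m → Ω) : ℝ) = (Fintype.card Ω : ℝ) ^ m := by
    simp
  rw [mul_pow, ← e4] at e3
  linarith

/-! ### Random coordinates and separation of all pairs -/

section Coordinates

variable {P : Type*} {X : Type*} [PseudoMetricSpace X]

/-- The randomness of one coordinate: eight labellings of the points, and signs. -/
abbrev CoordSample (P : Type*) (n : ℕ) : Type _ :=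
  (Fin 8 → P → Fin (2 ^ n)) × (Fin n × Fin 8 → Bool)

/-- One random coordinate: a signed sum of distances to random sets of all densities. -/
noncomputable def randomCoord (n : ℕ) (x : P → X) (ω : CoordSample P n) (z : X) : ℝ :=
  signedSum Finset.univ
    (fun p : Fin n × Fin 8 => Metric.infDist z (sampleSet n x p.1 (ω.1 p.2))) ω.2

lemma randomCoord_sub (n : ℕ) (x : P → X) (ω : CoordSample P n) (z w : X) :
    randomCoord n x ω z - randomCoord n x ω w = signedSum Finset.univ
      (fun p : Fin n × Fin 8 => Metric.infDist z (sampleSet n x p.1 (ω.1 p.2))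
        - Metric.infDist w (sampleSet n x p.1 (ω.1 p.2))) ω.2 := by
  simp only [randomCoord, signedSum, ← Finset.sum_sub_distrib, mul_sub]

lemma abs_randomCoord_sub_le (n : ℕ) (x : P → X) (ω : CoordSample P n) (z w : X) :
    |randomCoord n x ω z - randomCoord n x ω w| ≤ 8 * n * dist z w := by
  rw [randomCoord_sub, signedSum]
  refine (Finset.abs_sum_le_sum_abs _ _).trans ?_
  refine (Finset.sum_le_card_nsmul _ _ (dist z w) fun p _ => ?_).trans_eq ?_
  · rw [abs_mul, abs_boolSign, one_mul, ← Real.dist_eq]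
    simpa using (Metric.lipschitz_infDist_pt (sampleSet n x p.1 (ω.1 p.2))).dist_le_mul z w
  · simp [mul_comm]

variable [Fintype P] [DecidableEq P]

/-- The Laplace transform of a random coordinate, for a single pair of points. -/
lemma sum_exp_neg_randomCoord_le {n : ℕ} (hn : 1 ≤ n) (hP : Fintype.card P = 2 ^ n) (x : P → X)
    (i j : P) (hD : dist (x i) (x j) ≠ 0) :
    ∑ ω : CoordSample P n, Real.exp (-(4 * n / (3 * dist (x i) (x j) ^ 2)
        * (randomCoord n x ω (x i) - randomCoord n x ω (x j)) ^ 2))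
      ≤ (1 - (1 - (7 / 8 : ℝ) ^ 8) / 6) * Fintype.card (CoordSample P n) := by
  obtain ⟨ρ, hρ0, hρsum, hρ⟩ := exists_bourgain_scales n hP x i j
  set D := dist (x i) (x j)
  have hDpos : 0 < D := lt_of_le_of_ne dist_nonneg (Ne.symm hD)
  have hn' : (0 : ℝ) < n := by exact_mod_cast hn
  set V := ∑ t, ρ t ^ 2 with hV
  -- Cauchy–Schwarz on `∑ ρ t ≥ D / 2`; this fixes the factor `4n / (3D²)` in the exponent.
  have hVD : D ^ 2 / (4 * n) ≤ V := by
    have h1 := sq_sum_le_card_mul_sum_sq (s := (Finset.univ : Finset (Fin n))) (f := ρ)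
    rw [Finset.card_univ, Fintype.card_fin, ← hV] at h1
    rw [div_le_iff₀ (by positivity)]
    nlinarith
  have hVpos : 0 < V := lt_of_lt_of_le (by positivity) hVD
  have hc : 1 ≤ 4 * n / (3 * D ^ 2) * (3 * V) := by
    calc (1 : ℝ) = 4 * n / (3 * D ^ 2) * (3 * (D ^ 2 / (4 * n))) := by field_simp
      _ ≤ _ := by gcongr
  let δ : Fin n × Fin 8 → (Fin 8 → P → Fin (2 ^ n)) → ℝ := fun p w =>
    Metric.infDist (x i) (sampleSet n x p.1 (w p.2))
      - Metric.infDist (x j) (sampleSet n x p.1 (w p.2))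
  let g : Fin n → (Fin 8 → P → Fin (2 ^ n)) → ℝ := fun t w =>
    if ∃ l, ρ t ≤ |δ (t, l) w| then 1 else 0
  have hg0 : ∀ t w, 0 ≤ g t w := fun t w => by dsimp only [g]; split_ifs <;> norm_num
  have hg1 : ∀ t w, g t w ≤ 1 := fun t w => by dsimp only [g]; split_ifs <;> norm_num
  -- The share of `V` carried by scales that some labelling realises. The signs are averaged first
  -- with `w` fixed, then `θ` is averaged over `w`.
  let θ : (Fin 8 → P → Fin (2 ^ n)) → ℝ := fun w => (∑ t, ρ t ^ 2 * g t w) / V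
  have hθV : ∀ w, θ w * V = ∑ t, ρ t ^ 2 * g t w := fun w => div_mul_cancel₀ _ hVpos.ne'
  have hpair : ∀ w, ∑ σ : Fin n × Fin 8 → Bool, Real.exp (-(4 * n / (3 * D ^ 2)
        * (randomCoord n x (w, σ) (x i) - randomCoord n x (w, σ) (x j)) ^ 2))
      ≤ Fintype.card (Fin n × Fin 8 → Bool) * (1 - θ w / 6) := by
    intro w
    simp only [randomCoord_sub]
    refine sum_exp_neg_signedSum_sq_le (fun p => δ p w) hVpos ?_ ?_ ?_ hc
    · exact div_nonneg (Finset.sum_nonneg fun t _ => mul_nonneg (sq_nonneg _) (hg0 t w)) hVpos.le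
    · rw [div_le_one hVpos]
      exact Finset.sum_le_sum fun t _ => mul_le_of_le_one_right (sq_nonneg _) (hg1 t w)
    · rw [hθV, Fintype.sum_prod_type]
      refine Finset.sum_le_sum fun t _ => ?_
      by_cases hgt : ∃ l, ρ t ≤ |δ (t, l) w|
      · obtain ⟨l, hl⟩ := hgt
        have h1 : ρ t ^ 2 ≤ δ (t, l) w ^ 2 := by
          rw [← sq_abs (δ (t, l) w)]
          exact pow_le_pow_left₀ (hρ0 t) hl 2
        refine (mul_le_of_le_one_right (sq_nonneg _) (hg1 t w)).trans (h1.trans ?_)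
        exact Finset.single_le_sum (f := fun l => δ (t, l) w ^ 2) (fun _ _ => sq_nonneg _)
          (Finset.mem_univ l)
      · have : g t w = 0 := if_neg hgt
        rw [this, mul_zero]
        exact Finset.sum_nonneg fun _ _ => sq_nonneg _
  have hgsum : ∀ t, (1 - (7 / 8 : ℝ) ^ 8) * Fintype.card (Fin 8 → P → Fin (2 ^ n))
      ≤ ∑ w, g t w := by
    intro t
    have h1 := card_exists_coord_ge (fun v : P → Fin (2 ^ n) =>
      ρ t ≤ |Metric.infDist (x i) (sampleSet n x t v)
        - Metric.infDist (x j) (sampleSet n x t v)|) 8 (δ := 1 / 8) (hρ t)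
    have h2 : ∑ w, g t w = ((Finset.univ.filter fun w => ∃ l, ρ t ≤ |δ (t, l) w|).card : ℝ) := by
      simp [g]
    rw [h2]
    norm_num at h1 ⊢
    exact h1
  have hθsum : (1 - (7 / 8 : ℝ) ^ 8) * Fintype.card (Fin 8 → P → Fin (2 ^ n)) ≤ ∑ w, θ w := by
    rw [← Finset.sum_div, le_div_iff₀ hVpos, Finset.sum_comm, hV, Finset.mul_sum]
    refine Finset.sum_le_sum fun t _ => ?_
    rw [← Finset.mul_sum, mul_comm]
    exact mul_le_mul_of_nonneg_left (hgsum t) (sq_nonneg _)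
  rw [Fintype.sum_prod_type, Fintype.card_prod, Nat.cast_mul]
  refine (Finset.sum_le_sum fun w _ => hpair w).trans ?_
  rw [← Finset.mul_sum, Finset.sum_sub_distrib, Finset.sum_const, Finset.card_univ, nsmul_eq_mul,
    ← Finset.sum_div]
  have hB : (0 : ℝ) ≤ Fintype.card (Fin n × Fin 8 → Bool) := by positivity
  have := mul_le_mul_of_nonneg_left hθsum hB
  linarith

/-- Some `26 n` coordinates together separate all pairs of the `2 ^ n` points. -/
lemma exists_separating_coords {n : ℕ} (hn : 1 ≤ n) (hP : Fintype.card P = 2 ^ n) (x : P → X) :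
    ∃ ω : Fin (26 * n) → CoordSample P n, ∀ i j, 3 / 4 * dist (x i) (x j) ^ 2
      ≤ ∑ k, (randomCoord n x (ω k) (x i) - randomCoord n x (ω k) (x j)) ^ 2 := by
  classical
  set q : ℝ := 1 - (1 - (7 / 8 : ℝ) ^ 8) / 6 with hq
  let u : P × P → CoordSample P n → ℝ := fun p ω => 4 * n / (3 * dist (x p.1) (x p.2) ^ 2)
    * (randomCoord n x ω (x p.1) - randomCoord n x ω (x p.2)) ^ 2
  set T : Finset (P × P) := Finset.univ.filter fun p => dist (x p.1) (x p.2) ≠ 0 with hT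
  have hTcard : (T.card : ℝ) ≤ 4 ^ n := by
    have h1 : T.card ≤ 4 ^ n := by
      refine (Finset.card_le_univ T).trans_eq ?_
      rw [Fintype.card_prod, hP, ← mul_pow]
      norm_num
    exact_mod_cast h1
  have : Nonempty (CoordSample P n) := ⟨(fun _ _ => ⟨0, by positivity⟩, fun _ => true)⟩
  -- First-moment form of the union bound: for each pair, independence turns the total over samples
  -- into a power.
  have htotal : ∑ ω : Fin (26 * n) → CoordSample P n,
      ∑ p ∈ T, ∏ k, Real.exp (-(u p (ω k)))
      ≤ ∑ _ω : Fin (26 * n) → CoordSample P n, 4 ^ n * q ^ (26 * n) := by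
    rw [Finset.sum_comm, Finset.sum_const, Finset.card_univ, nsmul_eq_mul]
    have h1 : ∀ p ∈ T, ∑ ω : Fin (26 * n) → CoordSample P n, ∏ k, Real.exp (-(u p (ω k)))
        ≤ (q * Fintype.card (CoordSample P n)) ^ (26 * n) := by
      intro p hp
      rw [← Fintype.sum_pow (fun ω => Real.exp (-(u p ω)))]
      refine pow_le_pow_left₀ (Finset.sum_nonneg fun _ _ => (Real.exp_pos _).le) ?_ _
      exact sum_exp_neg_randomCoord_le hn hP x p.1 p.2 (Finset.mem_filter.1 hp).2
    refine (Finset.sum_le_card_nsmul _ _ _ h1).trans ?_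
    have h2 : (Fintype.card (Fin (26 * n) → CoordSample P n) : ℝ)
        = (Fintype.card (CoordSample P n) : ℝ) ^ (26 * n) := by
      rw [Fintype.card_fun, Fintype.card_fin, Nat.cast_pow]
    have hq0 : 0 ≤ q := by rw [hq]; norm_num
    rw [nsmul_eq_mul, h2, mul_pow]
    have h3 : (0 : ℝ) ≤ q ^ (26 * n) * (Fintype.card (CoordSample P n) : ℝ) ^ (26 * n) := by
      positivity
    linarith [mul_le_mul_of_nonneg_right hTcard h3]
  obtain ⟨ω, -, hω⟩ := Finset.exists_le_of_sum_le Finset.univ_nonempty htotal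
  refine ⟨ω, fun i j => ?_⟩
  by_cases hD : dist (x i) (x j) = 0
  · rw [hD]
    simpa using Finset.sum_nonneg fun k _ =>
      sq_nonneg (randomCoord n x (ω k) (x i) - randomCoord n x (ω k) (x j))
  have hmem : (i, j) ∈ T := Finset.mem_filter.2 ⟨Finset.mem_univ _, hD⟩
  have h1 : ∏ k, Real.exp (-(u (i, j) (ω k))) ≤ 4 ^ n * q ^ (26 * n) :=
    (Finset.single_le_sum (f := fun p => ∏ k, Real.exp (-(u p (ω k))))
      (fun p _ => Finset.prod_nonneg fun k _ => (Real.exp_pos _).le) hmem).trans hω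
  have h2 : (4 : ℝ) ^ n * q ^ (26 * n) ≤ Real.exp (-n) := by
    have h3 : 4 * q ^ 26 ≤ Real.exp (-1) := by
      have h4 : 4 * q ^ 26 ≤ 1 / 3 := by rw [hq]; norm_num
      have h5 : (1 / 3 : ℝ) ≤ Real.exp (-1) := by
        rw [Real.exp_neg, one_div]
        exact inv_anti₀ (Real.exp_pos _) (by linarith [Real.exp_one_lt_d9])
      exact h4.trans h5
    have hq0 : 0 ≤ q := by rw [hq]; norm_num
    calc (4 : ℝ) ^ n * q ^ (26 * n) = (4 * q ^ 26) ^ n := by rw [mul_pow, pow_mul]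
      _ ≤ Real.exp (-1) ^ n := pow_le_pow_left₀ (by positivity) h3 n
      _ = Real.exp (-n) := by rw [← Real.exp_nat_mul]; ring_nf
  rw [← Real.exp_sum] at h1
  -- The exponents of this pair sum to at least `n`; clearing `4n / (3D²)` leaves the constant
  -- `3/4`.
  have h6 := Real.exp_le_exp.1 (h1.trans h2)
  rw [Finset.sum_neg_distrib, neg_le_neg_iff] at h6
  simp only [u] at h6
  rw [← Finset.mul_sum] at h6
  have hn' : (0 : ℝ) < n := by exact_mod_cast hn
  have hDpos : 0 < dist (x i) (x j) := lt_of_le_of_ne dist_nonneg (Ne.symm hD)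
  rw [div_mul_eq_mul_div, le_div_iff₀ (by positivity)] at h6
  nlinarith

end Coordinates

/-! ### Extension of the inverse and stable encoding -/

/-- McShane extension with values in `C(S, ℝ)`. -/
lemma exists_lipschitz_extension_continuousMap {S : Type*} [TopologicalSpace S] [CompactSpace S]
    {Y : Type*} [PseudoMetricSpace Y] {P : Type*} [Fintype P] [Nonempty P] (x : P → C(S, ℝ))
    (y : P → Y) (L : ℝ≥0) (h : ∀ i j, dist (x i) (x j) ≤ L * dist (y i) (y j)) :
    ∃ M : Y → C(S, ℝ), LipschitzWith L M ∧ ∀ i, M (y i) = x i := by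
  let M : Y → C(S, ℝ) := fun v => Finset.univ.inf' Finset.univ_nonempty
    fun j => x j + ContinuousMap.const S (L * dist v (y j))
  have hM : ∀ v s, M v s = Finset.univ.inf' Finset.univ_nonempty
      fun j => x j s + L * dist v (y j) := by
    intro v s
    simp [M, ContinuousMap.inf'_apply]
  have hle : ∀ v w s, M v s ≤ M w s + L * dist v w := by
    intro v w s
    obtain ⟨j, -, hj⟩ := Finset.exists_mem_eq_inf' Finset.univ_nonempty
      (fun j => x j s + L * dist w (y j))
    rw [hM w, hj, hM v]
    refine (Finset.inf'_le _ (Finset.mem_univ j)).trans ?_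
    have := mul_le_mul_of_nonneg_left (dist_triangle v w (y j)) L.coe_nonneg
    linarith
  refine ⟨M, LipschitzWith.of_dist_le_mul fun v w => ?_, fun i => ?_⟩
  · rw [ContinuousMap.dist_le (by positivity)]
    intro s
    rw [Real.dist_eq, abs_le]
    have h1 := hle v w s
    have h2 := hle w v s
    rw [dist_comm w v] at h2
    constructor <;> linarith
  · ext s
    rw [hM]
    refine le_antisymm ((Finset.inf'_le _ (Finset.mem_univ i)).trans (by simp)) ?_
    refine Finset.le_inf' _ _ fun j _ => ?_
    have h1 := (ContinuousMap.dist_apply_le_dist (f := x i) (g := x j) s).trans (h i j)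
    rw [Real.dist_eq] at h1
    linarith [le_abs_self (x i s - x j s)]

/-- A stable encoder and decoder that are exact on `2 ^ n` given points. -/
lemma exists_stable_encoding {S : Type*} [TopologicalSpace S] [CompactSpace S] {n : ℕ}
    (hn : 1 ≤ n) (x : Fin (2 ^ n) → C(S, ℝ)) :
    ∃ (a : C(S, ℝ) → EuclideanSpace ℝ (Fin (26 * n)))
      (M : EuclideanSpace ℝ (Fin (26 * n)) → C(S, ℝ)),
      LipschitzWith (41 * (n : ℝ≥0) ^ (3 / 4 : ℝ)) a ∧
      LipschitzWith (41 * (n : ℝ≥0) ^ (3 / 4 : ℝ)) M ∧ ∀ i, M (a (x i)) = x i := by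
  obtain ⟨ω, hω⟩ := exists_separating_coords hn (Fintype.card_fin _) x
  set s : ℝ≥0 := (n : ℝ≥0) ^ (3 / 4 : ℝ) with hs
  have hn' : (0 : ℝ) < n := by exact_mod_cast hn
  have hs0 : (0 : ℝ) < s := by
    rw [hs, NNReal.coe_rpow]
    exact Real.rpow_pos_of_pos (by simpa using hn') _
  have hs4 : (s : ℝ) ^ 4 = (n : ℝ) ^ 3 := by
    rw [hs, NNReal.coe_rpow, NNReal.coe_natCast, ← Real.rpow_natCast, ← Real.rpow_mul hn'.le,
      ← Real.rpow_natCast]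
    norm_num
  let a : C(S, ℝ) → EuclideanSpace ℝ (Fin (26 * n)) := fun z =>
    WithLp.toLp 2 fun k => randomCoord n x (ω k) z / s
  have hdist : ∀ z w, dist (a z) (a w) ^ 2
      = (∑ k, (randomCoord n x (ω k) z - randomCoord n x (ω k) w) ^ 2) / s ^ 2 := by
    intro z w
    rw [EuclideanSpace.dist_eq, Real.sq_sqrt (Finset.sum_nonneg fun _ _ => sq_nonneg _),
      Finset.sum_div]
    refine Finset.sum_congr rfl fun k _ => ?_
    rw [Real.dist_eq, sq_abs, ← div_pow, ← sub_div]
  have hlower : ∀ i j, dist (x i) (x j) ≤ (41 * s : ℝ≥0) * dist (a (x i)) (a (x j)) := by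
    intro i j
    refine le_of_sq_le_sq ?_ (by positivity)
    rw [mul_pow, hdist]
    push_cast
    rw [mul_pow, mul_div_assoc', mul_right_comm, mul_div_assoc, div_self (by positivity), mul_one]
    nlinarith [hω i j, sq_nonneg (dist (x i) (x j))]
  obtain ⟨M, hM, hMx⟩ := exists_lipschitz_extension_continuousMap x (fun i => a (x i))
    (41 * s) hlower
  refine ⟨a, M, LipschitzWith.of_dist_le_mul fun z w => ?_, hM, hMx⟩
  refine le_of_sq_le_sq ?_ (by positivity)
  rw [hdist, div_le_iff₀ (by positivity)]
  have h1 : ∑ k, (randomCoord n x (ω k) z - randomCoord n x (ω k) w) ^ 2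
      ≤ 26 * n * (8 * n * dist z w) ^ 2 := by
    refine (Finset.sum_le_card_nsmul _ _ ((8 * n * dist z w) ^ 2) fun k _ => ?_).trans_eq ?_
    · rw [← sq_abs]
      exact pow_le_pow_left₀ (abs_nonneg _) (abs_randomCoord_sub_le n x (ω k) z w) 2
    · simp
  refine h1.trans ?_
  push_cast
  -- `41² = 1681` dominates `26 * 8² = 1664`.
  have h2 : (41 * (s : ℝ) * dist z w) ^ 2 * s ^ 2 = 1681 * n ^ 3 * dist z w ^ 2 := by
    rw [← hs4]; ring
  rw [h2]
  have h3 : 0 ≤ (n : ℝ) ^ 3 * dist z w ^ 2 := by positivity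
  nlinarith

/-! ### Covers at the entropy radius -/

/-- A set with more than `m` points cannot be covered by `m` arbitrarily small balls. -/
lemma exists_subset_range_of_forall_cover {X : Type*} [MetricSpace X] {K : Set X} {m : ℕ}
    (hm : 0 < m) (hK : K.Nonempty)
    (h : ∀ δ > 0, ∃ ε < δ, ∃ c : Fin m → X, K ⊆ ⋃ i, Metric.closedBall (c i) ε) :
    ∃ c : Fin m → X, K ⊆ Set.range c := by
  classical
  have : Nonempty (Fin m) := ⟨⟨0, hm⟩⟩
  have hcard : K.encard ≤ m := by
    by_contra! hlt
    obtain ⟨t, htK, ht⟩ := Set.exists_subset_encard_eq (Order.add_one_le_of_lt hlt)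
    have htfin : t.Finite := Set.finite_of_encard_eq_coe (k := m + 1) (by exact_mod_cast ht)
    lift t to Finset X using htfin
    rw [Set.encard_coe_eq_coe_finsetCard] at ht
    have ht' : t.card = m + 1 := by exact_mod_cast ht
    have hoff : t.offDiag.Nonempty := by
      obtain ⟨p, hp, q, hq, hpq⟩ := Finset.one_lt_card.1 (show 1 < t.card by omega)
      exact ⟨(p, q), Finset.mem_offDiag.2 ⟨hp, hq, hpq⟩⟩
    obtain ⟨⟨p, q⟩, hpq, hmin⟩ := Finset.exists_min_image t.offDiag (fun z => dist z.1 z.2) hoff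
    have hpos : 0 < dist p q := dist_pos.2 (Finset.mem_offDiag.1 hpq).2.2
    obtain ⟨ε, hε, c, hc⟩ := h (dist p q / 2) (by positivity)
    have hmem : ∀ z ∈ t, ∃ i, dist z (c i) ≤ ε := by
      intro z hz
      obtain ⟨i, hi⟩ := Set.mem_iUnion.1 (hc (htK hz))
      exact ⟨i, hi⟩
    choose! φ hφ using hmem
    obtain ⟨u, hu, v, hv, huv, he⟩ := Finset.exists_ne_map_eq_of_card_lt_of_maps_to
      (s := t) (t := (Finset.univ : Finset (Fin m))) (by simp [ht'])
      (f := φ) (fun _ _ => Finset.mem_coe.2 (Finset.mem_univ _))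
    have h1 := hmin (u, v) (Finset.mem_offDiag.2 ⟨hu, hv, huv⟩)
    have h2 := dist_triangle_right u v (c (φ u))
    have h3 := hφ u hu
    have h4 := hφ v hv
    rw [← he] at h4
    simp only at h1
    linarith
  have hfin : K.Finite := Set.finite_of_encard_le_coe hcard
  lift K to Finset X using hfin
  rw [Set.encard_coe_eq_coe_finsetCard] at hcard
  have hcard' : K.card ≤ m := by exact_mod_cast hcard
  obtain ⟨e⟩ : Nonempty (K ↪ Fin m) :=
    Function.Embedding.nonempty_of_card_le (by simpa using hcard')
  have : Nonempty K := let ⟨z, hz⟩ := hK; ⟨⟨z, hz⟩⟩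
  refine ⟨fun i => ((Function.invFun e i : K) : X), fun z hz => ⟨e ⟨z, hz⟩, ?_⟩⟩
  simp [Function.leftInverse_invFun e.injective _]

/-- The radius in the entropy number can be attained up to a factor `2`. -/
lemma exists_cover_le_two_mul_entropyNumber {X : Type*} [MetricSpace X] {K : Set X}
    (hK : K.Nonempty) (hKb : Bornology.IsBounded K) (n : ℕ) :
    ∃ c : Fin (2 ^ n) → X, ∀ z ∈ K, ∃ i, dist z (c i) ≤ 2 * entropyNumber n K := by
  set E := {ε : ℝ | 0 < ε ∧ ∃ c : Fin (2 ^ n) → X, K ⊆ ⋃ i, Metric.closedBall (c i) ε} with hE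
  have hEdef : entropyNumber n K = sInf E := rfl
  have hEne : E.Nonempty := by
    obtain ⟨z, hz⟩ := hK
    obtain ⟨r, hr⟩ := hKb.subset_closedBall z
    refine ⟨max r 1, by positivity, fun _ => z, fun w hw => Set.mem_iUnion.2 ⟨⟨0, by positivity⟩, ?_⟩⟩
    exact Metric.closedBall_subset_closedBall (le_max_left _ _) (hr hw)
  have h0 : 0 ≤ sInf E := Real.sInf_nonneg fun ε hε => hε.1.le
  rw [hEdef]
  rcases h0.eq_or_lt with h | h
  -- Doubling a zero infimum gains nothing, so here the centres must exhaust `K`.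
  · obtain ⟨c, hc⟩ := exists_subset_range_of_forall_cover (K := K) (m := 2 ^ n) (by positivity) hK
      (fun δ hδ => by
        obtain ⟨ε, hε, hlt⟩ := exists_lt_of_csInf_lt hEne (h ▸ hδ)
        exact ⟨ε, hlt, hε.2⟩)
    refine ⟨c, fun z hz => ?_⟩
    obtain ⟨i, rfl⟩ := hc hz
    exact ⟨i, by simp [← h]⟩
  · obtain ⟨ε, ⟨-, c, hc⟩, hlt⟩ := exists_lt_of_csInf_lt hEne (show sInf E < 2 * sInf E by linarith)
    refine ⟨c, fun z hz => ?_⟩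
    obtain ⟨i, hi⟩ := Set.mem_iUnion.1 (hc hz)
    exact ⟨i, (Metric.mem_closedBall.1 hi).trans hlt.le⟩

/-! ### The final estimate -/

theorem corollary5p4 :
    ∃ C : ℝ≥0, 0 < C ∧
      ∀ (S : Type*) [MetricSpace S] [CompactSpace S] (K : Set C(S, ℝ)), IsCompact K →
        ∀ n : ℕ, 1 ≤ n →
          ∃ (a : C(S, ℝ) → EuclideanSpace ℝ (Fin (26 * n)))
            (M : EuclideanSpace ℝ (Fin (26 * n)) → C(S, ℝ)),
            LipschitzWith (C * (n : ℝ≥0) ^ (3 / 4 : ℝ)) a ∧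
            LipschitzWith (C * (n : ℝ≥0) ^ (3 / 4 : ℝ)) M ∧
            ∀ f ∈ K, ‖f - M (a f)‖ ≤ (C : ℝ) * (n : ℝ) ^ (3 / 2 : ℝ) * entropyNumber n K := by
  -- `3364 = 2 * (1 + 41²)`: the triangle inequality at a centre within twice the entropy number.
  refine ⟨3364, by norm_num, fun S _ _ K hK n hn => ?_⟩
  obtain ⟨c, hc⟩ : ∃ c : Fin (2 ^ n) → C(S, ℝ),
      ∀ f ∈ K, ∃ i, dist f (c i) ≤ 2 * entropyNumber n K := by
    rcases K.eq_empty_or_nonempty with rfl | hne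
    · exact ⟨fun _ => 0, fun f hf => absurd hf (Set.notMem_empty f)⟩
    · exact exists_cover_le_two_mul_entropyNumber hne hK.isBounded n
  obtain ⟨a, M, ha, hM, hexact⟩ := exists_stable_encoding hn c
  have hCle : 41 * (n : ℝ≥0) ^ (3 / 4 : ℝ) ≤ 3364 * (n : ℝ≥0) ^ (3 / 4 : ℝ) := by
    gcongr
    norm_num
  refine ⟨a, M, ha.weaken hCle, hM.weaken hCle, fun f hf => ?_⟩
  obtain ⟨i, hi⟩ := hc f hf
  set r := (n : ℝ) ^ (3 / 2 : ℝ) with hr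
  have hn' : (1 : ℝ) ≤ n := by exact_mod_cast hn
  have hr1 : 1 ≤ r := Real.one_le_rpow hn' (by norm_num)
  have hsq : ((n : ℝ) ^ (3 / 4 : ℝ)) * (n : ℝ) ^ (3 / 4 : ℝ) = r := by
    rw [← Real.rpow_add (by linarith), hr]
    norm_num
  have h1 : dist (M (a (c i))) (M (a f)) ≤ 1681 * r * dist f (c i) := by
    have h2 := (hM.comp ha).dist_le_mul (c i) f
    rw [dist_comm (c i) f] at h2
    refine h2.trans_eq ?_
    push_cast
    rw [← hsq]
    ring
  rw [hexact] at h1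
  rw [← dist_eq_norm]
  have h3 := dist_triangle f (c i) (M (a f))
  have h0 : 0 ≤ dist f (c i) := dist_nonneg
  have h4 : dist f (M (a f)) ≤ 1682 * r * dist f (c i) := by nlinarith
  have h5 : 1682 * r * dist f (c i) ≤ 1682 * r * (2 * entropyNumber n K) := by gcongr
  push_cast
  linarith
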